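/- **Theorem 1.** Let $V$ be an $n$-dimensional real vector space with a basis $e_1,\dots,e_n$, equipped with a constant metric $g$ (a nondegenerate symmetric bilinear form, of any signature) and its flat Levi-Civita connection $\nabla$, that is, componentwise differentiation; indices refer to the basis $e_a$ and are raised with $g$. Let $\Omega\subseteq V$ be open. A $(0,4)$-tensor field $K$ on $\Omega$ is called Riemann-like if it is smooth and $K_{abcd}=-K_{bacd}$, $K_{abcd}=-K_{abdc}$, $K_{abcd}=K_{cdab}$. Let $\omega_1,\dots,\omega_m$, $m=\frac{n(n-1)}2$, be a basis of the space $\Lambda^2V^*$ of alternating bilinear forms on $V$, and put, for $1\le i\le j\le m$, $$T^{(i,j)}_{abcd}=\omega_i(e_a,e_b)\,\omega_j(e_c,e_d)+\omega_j(e_a,e_b)\,\omega_i(e_c,e_d).$$ 1. For every Riemann-like $K$ on $\Omega$, the $(0,2)$-tensor field $S_{ab}=\nabla^c\nabla^dK_{acbd}$ on $\Omega$ is smooth, symmetric ($S_{ab}=S_{ba}$) and divergence-free ($\nabla^aS_{ab}=0$). 2. Suppose that $n\neq 1$ and that $\Omega$ is star-shaped (for example $\Omega=V$). Then for a $(0,2)$-tensor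 field $S$ on $\Omega$ the following are equivalent: - $S$ is smooth, symmetric and divergence-free; - $S_{ab}=\nabla^c\nabla^dK_{acbd}$ on $\Omega$ for some Riemann-like $(0,4)$-tensor field $K$ on $\Omega$; - there are smooth functions $c_{ij}:\Omega\to\mathbb R$, $1\le i\le j\le m$, such that on $\Omega$ $$S_{ab}=\sum_{1\le i\le j\le m}T^{(i,j)}_{acbd}\,\nabla^c\nabla^dc_{ij}.$$ -/

import Mathlib

open scoped ContDiff

namespace FlatTensor

section

variable {V : Type*} [NormedAddCommGroup V] [NormedSpace ℝ V] {n m : ℕ}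

/-- Covariant tensors of type `(0,k)` on the vector space `V`; a `(0,k)`-tensor field on an open
set of the flat space `V` is a function from `V` to this space, looked at on that set. -/
abbrev Tensor (V : Type*) [NormedAddCommGroup V] [NormedSpace ℝ V] (k : ℕ) : Type _ :=
  ContinuousMultilinearMap ℝ (fun _ : Fin k => V) ℝ

/-- The components `g^{cd}` of the inverse metric in the basis `e`. -/
noncomputable def invMetric (g : LinearMap.BilinForm ℝ V) (e : Module.Basis (Fin n) ℝ V) :
    Matrix (Fin n) (Fin n) ℝ :=
  (Matrix.of fun a b => g (e a) (e b))⁻¹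

/-- `∇^c f = g^{cd} ∇_{e_d} f` for a tensor field `f` (of any type, scalar fields included).
The metric `g` is constant on `V`, so its Christoffel symbols in the affine coordinates of `V`
vanish and the covariant derivative of its Levi-Civita connection in the direction `v` is the
directional derivative of the tensor-valued map `f`. -/
noncomputable def nablaUp {F : Type*} [NormedAddCommGroup F] [NormedSpace ℝ F]
    (g : LinearMap.BilinForm ℝ V) (e : Module.Basis (Fin n) ℝ V) (c : Fin n) (f : V → F) : V → F :=
  fun x => ∑ d, invMetric g e c d • fderiv ℝ f x (e d)

/-- Riemann-like symmetries of a `(0,4)`-tensor: antisymmetric in the first and in the second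
pair of arguments, and symmetric under the exchange of the two pairs. -/
structure IsRiemannLike (K : Tensor V 4) : Prop where
  antisymm_left : ∀ u v w z : V, K ![u, v, w, z] = -K ![v, u, w, z]
  antisymm_right : ∀ u v w z : V, K ![u, v, w, z] = -K ![u, v, z, w]
  pair_symm : ∀ u v w z : V, K ![u, v, w, z] = K ![w, z, u, v]

/-- Smooth `(0,4)`-tensor fields on `Ω` with Riemann-like symmetries. -/
structure IsRiemannLikeField (Ω : Set V) (K : V → Tensor V 4) : Prop where
  smooth : ContDiffOn ℝ ∞ K Ω
  riemannLike : ∀ x ∈ Ω, IsRiemannLike (K x)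

/-- The components `∇^c ∇^d K_{acbd}` at `x`. -/
noncomputable def doubleDiv (g : LinearMap.BilinForm ℝ V) (e : Module.Basis (Fin n) ℝ V)
    (K : V → Tensor V 4) (x : V) (a b : Fin n) : ℝ :=
  ∑ c, ∑ d, nablaUp g e c (nablaUp g e d K) x ![e a, e c, e b, e d]

/-- Smooth symmetric divergence-free `(0,2)`-tensor fields on `Ω`: `S_{ab} = S_{ba}` and
`∇^a S_{ab} = 0`. -/
structure IsDFST (g : LinearMap.BilinForm ℝ V) (e : Module.Basis (Fin n) ℝ V) (Ω : Set V)
    (S : V → Tensor V 2) : Prop where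
  smooth : ContDiffOn ℝ ∞ S Ω
  symm : ∀ x ∈ Ω, ∀ u v : V, S x ![u, v] = S x ![v, u]
  div_eq_zero : ∀ x ∈ Ω, ∀ b, ∑ a, nablaUp g e a S x ![e a, e b] = 0

/-- The components `T^{(i,j)}_{abcd}` of the tensor `η_i ⊗ η_j + η_j ⊗ η_i`. -/
noncomputable def basisTensor (e : Module.Basis (Fin n) ℝ V) (η : Module.Basis (Fin m) ℝ (V [⋀^Fin 2]→ₗ[ℝ] ℝ))
    (i j : Fin m) (a b c d : Fin n) : ℝ :=
  η i ![e a, e b] * η j ![e c, e d] + η j ![e a, e b] * η i ![e c, e d]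

/-- The components `∑_{i ≤ j} T^{(i,j)}_{acbd} ∇^c ∇^d f_{ij}` at `x`. -/
noncomputable def potentialSum (g : LinearMap.BilinForm ℝ V) (e : Module.Basis (Fin n) ℝ V)
    (η : Module.Basis (Fin m) ℝ (V [⋀^Fin 2]→ₗ[ℝ] ℝ)) (f : Fin m → Fin m → V → ℝ)
    (x : V) (a b : Fin n) : ℝ :=
  ∑ i, ∑ j ∈ Finset.Ici i, ∑ c, ∑ d,
    basisTensor e η i j a c b d * nablaUp g e c (nablaUp g e d (f i j)) x

end

end FlatTensor

/-! The double divergence is symmetric because $K$ has pair symmetry and flat derivatives commute.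
It is divergence-free because $\nabla^a\nabla^c$ is contracted with $\nabla^dK_{acbd}$, which is
antisymmetric in $a,c$.

Conversely, let $\Omega$ be star-shaped about $p$, let $X_a=g(x-p,e_a)$, and let $E$ be the
derivative along $x-p$. For $s$ symmetric and divergence-free, the field
$K_{acbd}=X_d(X_cs_{ab}-X_as_{cb})-X_b(X_cs_{ad}-X_as_{cd})$ is Riemann-like. Since
$\nabla^dX_b=\delta^d_b$ and $X_d\nabla^d=E$, its double divergence is $(E+n)(E+n-1)s_{ab}$. It
remains to solve $(E+n-1)s=u$, $(E+n)u=S$. Integration by parts along rays gives the solutions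
$u=\int_0^1t^{n-1}S(p+t(x-p))\,dt$ and $s=\int_0^1t^{n-2}(1-t)S(p+t(x-p))\,dt$, which inherit
smoothness, symmetry and zero divergence from $S$ (`sum_dirDeriv_sum_dirDeriv_potential`,
`exists_isRiemannLikeField`).

For the scalar potentials, a Riemann-like tensor lies in $\mathrm{Sym}^2(\Lambda^2V^*)$, which the
constant tensors $T^{(i,j)}$ span. Derivatives of $K$ therefore fall on its coefficients only
(`exists_coefficients`, `potentialSum_eq`). -/

namespace FlatTensor

/-! ### Weighted averages along rays -/

section RayAverage

variable {V : Type*} [NormedAddCommGroup V] [NormedSpace ℝ V]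

/-- The weighted average `∫₀¹ w(t) f(p + t(x - p)) dt` of `f` along the segment from `p` to `x`. -/
noncomputable def rayAverage (p : V) (w : ℝ → ℝ) (f : V → ℝ) (x : V) : ℝ :=
  ∫ t in (0 : ℝ)..1, w t * f (p + t • (x - p))

variable {p : V} {Ω : Set V} {w : ℝ → ℝ} {f : V → ℝ}

theorem continuousOn_comp_ray {F : Type*} [TopologicalSpace F] {h : V → F}
    (hs : StarConvex ℝ p Ω) (hf : ContinuousOn h Ω) {x : V} (hx : x ∈ Ω) :
    ContinuousOn (fun t : ℝ => h (p + t • (x - p))) (Set.uIcc 0 1) := by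
  refine hf.comp (by fun_prop) fun t ht => ?_
  rw [Set.uIcc_of_le zero_le_one] at ht
  exact hs.add_smul_sub_mem hx ht.1 ht.2

/-- Differentiation under the integral sign. Star-shapedness keeps all segments from $p$ to a small
closed ball around $x$ inside $\Omega$. -/
theorem hasFDerivAt_rayAverage [FiniteDimensional ℝ V] (hs : StarConvex ℝ p Ω) (hΩ : IsOpen Ω)
    (hw : Continuous w) (hf : ContDiffOn ℝ 1 f Ω) {x : V} (hx : x ∈ Ω) :
    HasFDerivAt (rayAverage p w f)
      (∫ t in (0 : ℝ)..1, (w t * t) • fderiv ℝ f (p + t • (x - p))) x := by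
  have hdf : ContinuousOn (fderiv ℝ f) Ω := hf.continuousOn_fderiv_of_isOpen hΩ le_rfl
  obtain ⟨r, hr, hrΩ⟩ := Metric.nhds_basis_closedBall.mem_iff.1 (hΩ.mem_nhds hx)
  have hmem : ∀ y ∈ Metric.closedBall x r, ∀ t ∈ Set.Icc (0 : ℝ) 1, p + t • (y - p) ∈ Ω :=
    fun y hy t ht => hs.add_smul_sub_mem (hrΩ hy) ht.1 ht.2
  have hcont : ContinuousOn (fun q : ℝ × V => (w q.1 * q.1) • fderiv ℝ f (p + q.1 • (q.2 - p)))
      (Set.Icc 0 1 ×ˢ Metric.closedBall x r) := by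
    have h1 : Continuous fun q : ℝ × V => w q.1 * q.1 := by fun_prop
    have h2 : Continuous fun q : ℝ × V => p + q.1 • (q.2 - p) := by fun_prop
    exact h1.continuousOn.smul
      (hdf.comp h2.continuousOn fun q hq => hmem q.2 hq.2 q.1 hq.1)
  have hpr : ProperSpace V := FiniteDimensional.proper ℝ V
  -- Compactness of $[0,1]$ times the closed ball makes a constant serve as the dominating function.
  obtain ⟨C, hC⟩ := (isCompact_Icc.prod (isCompact_closedBall x r)).exists_bound_of_continuousOn
    hcont
  have hsub : Set.uIoc (0 : ℝ) 1 ⊆ Set.Icc 0 1 := by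
    rw [Set.uIoc_of_le zero_le_one]; exact Set.Ioc_subset_Icc_self
  have hII : ∀ y ∈ Ω, IntervalIntegrable (fun t => w t * f (p + t • (y - p)))
      MeasureTheory.volume 0 1 := fun y hy =>
    (hw.continuousOn.mul (continuousOn_comp_ray hs hf.continuousOn hy)).intervalIntegrable
  refine intervalIntegral.hasFDerivAt_integral_of_dominated_of_fderiv_le (𝕜 := ℝ)
    (F := fun y t => w t * f (p + t • (y - p)))
    (F' := fun y t => (w t * t) • fderiv ℝ f (p + t • (y - p)))
    (bound := fun _ => C) (Metric.closedBall_mem_nhds x hr) ?_ (hII x hx) ?_ ?_ (by simp) ?_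
  · filter_upwards [hΩ.mem_nhds hx] with y hy
    exact (hII y hy).aestronglyMeasurable_restrict_uIoc
  · have : ContinuousOn (fun t : ℝ => (w t * t) • fderiv ℝ f (p + t • (x - p))) (Set.uIcc 0 1) :=
      (hw.mul continuous_id).continuousOn.smul (continuousOn_comp_ray hs hdf hx)
    exact this.intervalIntegrable.aestronglyMeasurable_restrict_uIoc
  · exact .of_forall fun t ht y hy => hC (t, y) ⟨hsub ht, hy⟩
  · refine .of_forall fun t ht y hy => ?_
    have hd : HasFDerivAt f (fderiv ℝ f (p + t • (y - p))) (p + t • (y - p)) :=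
      ((hf.contDiffAt (hΩ.mem_nhds (hmem y hy t (hsub ht)))).differentiableAt
        one_ne_zero).hasFDerivAt
    have hi : HasFDerivAt (fun z : V => p + t • (z - p)) (t • ContinuousLinearMap.id ℝ V) y :=
      (((hasFDerivAt_id y).sub_const p).const_smul t).const_add p
    refine ((hd.comp y hi).const_mul (w t)).congr_fderiv ?_
    ext v
    simp [mul_assoc]

/-- The chain-rule factor $t$ is absorbed into the weight, so a derivative of a ray average is again
a ray average. Hence the weight is kept arbitrary in the induction for smoothness. -/
theorem fderiv_rayAverage [FiniteDimensional ℝ V] (hs : StarConvex ℝ p Ω) (hΩ : IsOpen Ω)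
    (hw : Continuous w) (hf : ContDiffOn ℝ 1 f Ω) {x : V} (hx : x ∈ Ω) (v : V) :
    fderiv ℝ (rayAverage p w f) x v =
      rayAverage p (fun t => w t * t) (fun y => fderiv ℝ f y v) x := by
  have hdf : ContinuousOn (fderiv ℝ f) Ω := hf.continuousOn_fderiv_of_isOpen hΩ le_rfl
  have : ContinuousOn (fun t : ℝ => (w t * t) • fderiv ℝ f (p + t • (x - p))) (Set.uIcc 0 1) :=
    (hw.mul continuous_id).continuousOn.smul (continuousOn_comp_ray hs hdf hx)
  rw [(hasFDerivAt_rayAverage hs hΩ hw hf hx).fderiv,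
    ContinuousLinearMap.intervalIntegral_apply this.intervalIntegrable]
  rfl

theorem contDiffOn_fderiv_apply (hΩ : IsOpen Ω) (hf : ContDiffOn ℝ ∞ f Ω) (v : V) :
    ContDiffOn ℝ ∞ (fun y => fderiv ℝ f y v) Ω :=
  ((contDiffOn_infty_iff_fderiv_of_isOpen hΩ).1 hf).2.clm_apply contDiffOn_const

theorem contDiffOn_rayAverage [FiniteDimensional ℝ V] (hs : StarConvex ℝ p Ω) (hΩ : IsOpen Ω)
    (hw : Continuous w) (hf : ContDiffOn ℝ ∞ f Ω) : ContDiffOn ℝ ∞ (rayAverage p w f) Ω := by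
  have hf1 : ∀ {f : V → ℝ}, ContDiffOn ℝ ∞ f Ω → ContDiffOn ℝ 1 f Ω := fun h =>
    h.of_le (by exact_mod_cast le_top)
  refine contDiffOn_infty.2 fun k => ?_
  induction k generalizing w f with
  | zero =>
    exact contDiffOn_zero.2 fun x hx =>
      (hasFDerivAt_rayAverage hs hΩ hw (hf1 hf) hx).continuousAt.continuousWithinAt
  | succ k ih =>
    rw [Nat.cast_add, Nat.cast_one, contDiffOn_succ_iff_fderiv_of_isOpen hΩ]
    refine ⟨fun x hx => (hasFDerivAt_rayAverage hs hΩ hw (hf1 hf) hx).differentiableAt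
      |>.differentiableWithinAt, by simp, contDiffOn_clm_apply.2 fun v => ?_⟩
    exact (ih (w := fun t => w t * t) (by fun_prop) (contDiffOn_fderiv_apply hΩ hf v)).congr
      fun x hx => fderiv_rayAverage hs hΩ hw (hf1 hf) hx v

/-- Integration by parts along the segment from `p` to `x`. -/
theorem fderiv_rayAverage_sub [FiniteDimensional ℝ V] (hs : StarConvex ℝ p Ω) (hΩ : IsOpen Ω)
    (hw : Continuous w) {w' : ℝ → ℝ} (hw'c : Continuous w')
    (hw' : ∀ t, HasDerivAt (fun t => w t * t) (w' t) t)
    (hf : ContDiffOn ℝ 1 f Ω) {x : V} (hx : x ∈ Ω) :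
    fderiv ℝ (rayAverage p w f) x (x - p) = w 1 * f x - rayAverage p w' f x := by
  have hdf : ContinuousOn (fun y => fderiv ℝ f y (x - p)) Ω :=
    (hf.continuousOn_fderiv_of_isOpen hΩ le_rfl).clm_apply continuousOn_const
  have hder : ∀ t ∈ Set.uIcc (0 : ℝ) 1, HasDerivAt (fun t : ℝ => f (p + t • (x - p)))
      (fderiv ℝ f (p + t • (x - p)) (x - p)) t := fun t ht => by
    rw [Set.uIcc_of_le zero_le_one] at ht
    have hd : HasFDerivAt f (fderiv ℝ f (p + t • (x - p))) (p + t • (x - p)) :=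
      ((hf.contDiffAt (hΩ.mem_nhds (hs.add_smul_sub_mem hx ht.1 ht.2))).differentiableAt
        one_ne_zero).hasFDerivAt
    have hi : HasDerivAt (fun t : ℝ => p + t • (x - p)) (x - p) t := by
      simpa using ((hasDerivAt_id t).smul_const (x - p)).const_add p
    exact hd.comp_hasDerivAt t hi
  -- The function integrated against the derivative is $w(t)t$, so there is no boundary term at
  -- $t=0$.
  have h := intervalIntegral.integral_mul_deriv_eq_deriv_mul (fun t _ => hw' t) hder
    hw'c.continuousOn.intervalIntegrable (continuousOn_comp_ray hs hdf hx).intervalIntegrable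
  rw [fderiv_rayAverage hs hΩ hw hf hx]
  simpa [rayAverage] using h

end RayAverage

/-! ### Calculus of directional derivatives of scalar fields -/

section DirDeriv

variable {V : Type*} [NormedAddCommGroup V] [NormedSpace ℝ V] {Ω : Set V}

/-- The derivative of a scalar field in a constant direction. -/
noncomputable def dirDeriv (v : V) (f : V → ℝ) (x : V) : ℝ := fderiv ℝ f x v

theorem differentiableAt_of_smoothOn {F : Type*} [NormedAddCommGroup F] [NormedSpace ℝ F]
    {f : V → F} (hΩ : IsOpen Ω) (hf : ContDiffOn ℝ ∞ f Ω) {x : V} (hx : x ∈ Ω) :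
    DifferentiableAt ℝ f x :=
  (hf.contDiffAt (hΩ.mem_nhds hx)).differentiableAt (by simp)

theorem contDiffOn_dirDeriv (hΩ : IsOpen Ω) {f : V → ℝ} (hf : ContDiffOn ℝ ∞ f Ω) (v : V) :
    ContDiffOn ℝ ∞ (dirDeriv v f) Ω :=
  contDiffOn_fderiv_apply hΩ hf v

theorem dirDeriv_congr (hΩ : IsOpen Ω) {f h : V → ℝ} (hfh : ∀ x ∈ Ω, f x = h x) (v : V)
    {x : V} (hx : x ∈ Ω) : dirDeriv v f x = dirDeriv v h x := by
  have : f =ᶠ[nhds x] h := Filter.eventually_of_mem (hΩ.mem_nhds hx) hfh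
  rw [dirDeriv, dirDeriv, this.fderiv_eq]

theorem dirDeriv_sum (hΩ : IsOpen Ω) {ι : Type*} {s : Finset ι} {f : ι → V → ℝ}
    (hf : ∀ i ∈ s, ContDiffOn ℝ ∞ (f i) Ω) (v : V) {x : V} (hx : x ∈ Ω) :
    dirDeriv v (fun y => ∑ i ∈ s, f i y) x = ∑ i ∈ s, dirDeriv v (f i) x := by
  rw [dirDeriv, fderiv_fun_sum fun i hi => differentiableAt_of_smoothOn hΩ (hf i hi) hx]
  simp [dirDeriv]

theorem dirDeriv_mul (hΩ : IsOpen Ω) {f h : V → ℝ} (hf : ContDiffOn ℝ ∞ f Ω)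
    (hh : ContDiffOn ℝ ∞ h Ω) (v : V) {x : V} (hx : x ∈ Ω) :
    dirDeriv v (fun y => f y * h y) x = dirDeriv v f x * h x + f x * dirDeriv v h x := by
  rw [dirDeriv, fderiv_fun_mul (differentiableAt_of_smoothOn hΩ hf hx)
    (differentiableAt_of_smoothOn hΩ hh hx)]
  simp [dirDeriv]
  ring

theorem dirDeriv_add (hΩ : IsOpen Ω) {f h : V → ℝ} (hf : ContDiffOn ℝ ∞ f Ω)
    (hh : ContDiffOn ℝ ∞ h Ω) (v : V) {x : V} (hx : x ∈ Ω) :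
    dirDeriv v (fun y => f y + h y) x = dirDeriv v f x + dirDeriv v h x := by
  rw [dirDeriv, fderiv_fun_add (differentiableAt_of_smoothOn hΩ hf hx)
    (differentiableAt_of_smoothOn hΩ hh hx)]
  simp [dirDeriv]

theorem dirDeriv_sub (hΩ : IsOpen Ω) {f h : V → ℝ} (hf : ContDiffOn ℝ ∞ f Ω)
    (hh : ContDiffOn ℝ ∞ h Ω) (v : V) {x : V} (hx : x ∈ Ω) :
    dirDeriv v (fun y => f y - h y) x = dirDeriv v f x - dirDeriv v h x := by
  rw [dirDeriv, fderiv_fun_sub (differentiableAt_of_smoothOn hΩ hf hx)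
    (differentiableAt_of_smoothOn hΩ hh hx)]
  simp [dirDeriv]

theorem dirDeriv_neg (f : V → ℝ) (v x : V) :
    dirDeriv v (fun y => -f y) x = -dirDeriv v f x := by
  simp [dirDeriv]

theorem dirDeriv_const_mul (hΩ : IsOpen Ω) {f : V → ℝ} (hf : ContDiffOn ℝ ∞ f Ω) (r : ℝ)
    (v : V) {x : V} (hx : x ∈ Ω) :
    dirDeriv v (fun y => r * f y) x = r * dirDeriv v f x := by
  rw [dirDeriv, fderiv_const_mul (differentiableAt_of_smoothOn hΩ hf hx)]
  simp [dirDeriv]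

theorem dirDeriv_comm (hΩ : IsOpen Ω) {f : V → ℝ} (hf : ContDiffOn ℝ ∞ f Ω) (u v : V)
    {x : V} (hx : x ∈ Ω) :
    dirDeriv u (dirDeriv v f) x = dirDeriv v (dirDeriv u f) x := by
  have hd : DifferentiableAt ℝ (fderiv ℝ f) x :=
    differentiableAt_of_smoothOn hΩ ((contDiffOn_infty_iff_fderiv_of_isOpen hΩ).1 hf).2 hx
  have key : ∀ u v : V, dirDeriv u (dirDeriv v f) x = fderiv ℝ (fderiv ℝ f) x u v := by
    intro u v
    have := (hd.hasFDerivAt.clm_apply (hasFDerivAt_const v x)).fderiv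
    unfold dirDeriv
    rw [this]
    simp
  rw [key, key]
  exact ((hf.contDiffAt (hΩ.mem_nhds hx)).isSymmSndFDerivAt
    (by rw [minSmoothness_of_isRCLikeNormedField]; exact WithTop.coe_le_coe.2 le_top)) u v

end DirDeriv

/-! ### The metric and the reciprocal basis -/

section Metric

variable {V : Type*} [NormedAddCommGroup V] [NormedSpace ℝ V] {n : ℕ}

/-- The reciprocal basis `g^{cd} e_d`. -/
noncomputable def upVec (g : LinearMap.BilinForm ℝ V) (e : Module.Basis (Fin n) ℝ V)
    (c : Fin n) : V :=
  ∑ d, invMetric g e c d • e d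

variable (g : LinearMap.BilinForm ℝ V) (e : Module.Basis (Fin n) ℝ V)

theorem nablaUp_eq {F : Type*} [NormedAddCommGroup F] [NormedSpace ℝ F] (c : Fin n)
    (f : V → F) (x : V) : nablaUp g e c f x = fderiv ℝ f x (upVec g e c) := by
  simp [nablaUp, upVec]

theorem nablaUp_eq_dirDeriv (c : Fin n) (f : V → ℝ) :
    nablaUp g e c f = dirDeriv (upVec g e c) f :=
  funext fun x => nablaUp_eq g e c f x

theorem isUnit_det_gram (hg : g.Nondegenerate) :
    IsUnit (Matrix.of fun a b => g (e a) (e b)).det := by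
  have h := (LinearMap.BilinForm.nondegenerate_iff_det_ne_zero e).1 hg
  rw [isUnit_iff_ne_zero]
  convert h using 2
  ext a b
  simp [LinearMap.BilinForm.toMatrix_apply]

theorem apply_upVec_basis (hg : g.Nondegenerate) (c a : Fin n) :
    g (upVec g e c) (e a) = if c = a then 1 else 0 := by
  have h := congrFun (congrFun (Matrix.nonsing_inv_mul _ (isUnit_det_gram g e hg)) c) a
  rw [Matrix.mul_apply, Matrix.one_apply] at h
  simpa [upVec, invMetric] using h

/-- Used with $y=x-p$, this identifies $\sum_cX_c\nabla^c$ with the Euler derivative along $x-p$. -/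
theorem sum_smul_upVec (hg : g.Nondegenerate) (y : V) :
    ∑ c, g y (e c) • upVec g e c = y := by
  have h1 : ∀ a, ∑ c, g (e a) (e c) • upVec g e c = e a := fun a => by
    have h : ∀ d, ∑ c, g (e a) (e c) * invMetric g e c d = if a = d then 1 else 0 := fun d => by
      have h := congrFun (congrFun (Matrix.mul_nonsing_inv _ (isUnit_det_gram g e hg)) a) d
      rwa [Matrix.mul_apply, Matrix.one_apply] at h
    simp only [upVec, Finset.smul_sum, smul_smul]
    rw [Finset.sum_comm]
    simp [← Finset.sum_smul, h]
  let L : V →ₗ[ℝ] V := ∑ c, (g.flip (e c)).smulRight (upVec g e c)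
  have hL : ∀ z, L z = ∑ c, g z (e c) • upVec g e c := fun z => by simp [L]
  have : L = LinearMap.id := e.ext fun a => by rw [hL, h1, LinearMap.id_apply]
  rw [← hL, this, LinearMap.id_apply]

end Metric

/-! ### Tensors and their components -/

section Components

variable {V : Type*} [NormedAddCommGroup V] [NormedSpace ℝ V] {n k : ℕ}
  (e : Module.Basis (Fin n) ℝ V)

/-- The tensor product of the coordinate functionals with indices `I`. -/
noncomputable def coordTensor [FiniteDimensional ℝ V] (I : Fin k → Fin n) : Tensor V k :=
  (ContinuousMultilinearMap.mkPiAlgebra ℝ (Fin k) ℝ).compContinuousLinearMap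
    fun i => LinearMap.toContinuousLinearMap (e.coord (I i))

theorem coordTensor_basis [FiniteDimensional ℝ V] (I J : Fin k → Fin n) :
    coordTensor e I (fun i => e (J i)) = if I = J then 1 else 0 := by
  simp only [coordTensor, ContinuousMultilinearMap.compContinuousLinearMap_apply,
    ContinuousMultilinearMap.mkPiAlgebra_apply, LinearMap.coe_toContinuousLinearMap',
    Module.Basis.coord_apply, Module.Basis.repr_self, Finsupp.single_apply]
  split_ifs with h
  · exact Finset.prod_eq_one fun i _ => by simp [h]
  · obtain ⟨i, hi⟩ := Function.ne_iff.1 h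
    exact Finset.prod_eq_zero (Finset.mem_univ i) (by simp [Ne.symm hi])

theorem tensor_ext {T T' : Tensor V k}
    (h : ∀ I : Fin k → Fin n, T (fun i => e (I i)) = T' (fun i => e (I i))) : T = T' :=
  ContinuousMultilinearMap.toMultilinearMap_injective
    (Module.Basis.ext_multilinear (fun _ => e) h)

theorem sum_coordTensor_basis [FiniteDimensional ℝ V] (t : (Fin k → Fin n) → ℝ) (J : Fin k → Fin n) :
    (∑ I, t I • coordTensor e I) (fun i => e (J i)) = t J := by
  simp [coordTensor_basis]

theorem eq_sum_coordTensor [FiniteDimensional ℝ V] (T : Tensor V k) :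
    T = ∑ I : Fin k → Fin n, T (fun i => e (I i)) • coordTensor e I :=
  tensor_ext e fun J => (sum_coordTensor_basis e (fun I => T fun i => e (I i)) J).symm

theorem contDiffOn_of_components [FiniteDimensional ℝ V] {Ω : Set V} {T : V → Tensor V k}
    (h : ∀ I : Fin k → Fin n, ContDiffOn ℝ ∞ (fun x => T x (fun i => e (I i))) Ω) :
    ContDiffOn ℝ ∞ T Ω := by
  have : T = fun x => ∑ I : Fin k → Fin n, T x (fun i => e (I i)) • coordTensor e I :=
    funext fun x => eq_sum_coordTensor e (T x)
  rw [this]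
  exact ContDiffOn.sum fun I _ => (h I).smul contDiffOn_const

theorem contDiffOn_component {Ω : Set V} {T : V → Tensor V k} (h : ContDiffOn ℝ ∞ T Ω)
    (v : Fin k → V) : ContDiffOn ℝ ∞ (fun x => T x v) Ω :=
  (ContinuousMultilinearMap.apply ℝ (fun _ : Fin k => V) ℝ v).contDiff.comp_contDiffOn h

/-- A symmetry of a tensor under a permutation of its arguments can be checked on components. -/
theorem apply_comp_perm (σ : Equiv.Perm (Fin k)) (r : ℝ) {T : Tensor V k}
    (h : ∀ I : Fin k → Fin n, T (fun i => e (I (σ i))) = r * T (fun i => e (I i)))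
    (v : Fin k → V) : T (fun i => v (σ i)) = r * T v := by
  have : T.toMultilinearMap.domDomCongr σ = r • T.toMultilinearMap :=
    Module.Basis.ext_multilinear (fun _ => e) fun I => h I
  exact congrArg (fun M : MultilinearMap ℝ (fun _ : Fin k => V) ℝ => M v) this

theorem basis_comp_vec2 (I : Fin 2 → Fin n) : (fun i => e (I i)) = ![e (I 0), e (I 1)] := by
  ext i; fin_cases i <;> rfl

theorem basis_comp_vec4 (I : Fin 4 → Fin n) :
    (fun i => e (I i)) = ![e (I 0), e (I 1), e (I 2), e (I 3)] := by
  ext i; fin_cases i <;> rfl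

/-- The `(0,4)`-tensor with given components. -/
noncomputable def tensorOf [FiniteDimensional ℝ V] (t : Fin n → Fin n → Fin n → Fin n → ℝ) : Tensor V 4 :=
  ∑ I : Fin 4 → Fin n, t (I 0) (I 1) (I 2) (I 3) • coordTensor e I

theorem tensorOf_basis [FiniteDimensional ℝ V] (t : Fin n → Fin n → Fin n → Fin n → ℝ) (a b c d : Fin n) :
    tensorOf e t ![e a, e b, e c, e d] = t a b c d := by
  have h := sum_coordTensor_basis e (fun I : Fin 4 → Fin n => t (I 0) (I 1) (I 2) (I 3))
    ![a, b, c, d]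
  rw [basis_comp_vec4] at h
  exact h

theorem apply_swap_of_components {S : Tensor V 2}
    (h : ∀ a b, S ![e a, e b] = S ![e b, e a]) (u v : V) : S ![u, v] = S ![v, u] := by
  have := apply_comp_perm e (Equiv.swap 0 1) 1 (T := S) (fun I => ?_) ![v, u]
  · rw [one_mul] at this
    rw [← this]
    congr 1
    ext i; fin_cases i <;> rfl
  · rw [one_mul, basis_comp_vec2 e I, ← h, basis_comp_vec2 e fun i => I (Equiv.swap 0 1 i)]
    rfl

theorem isRiemannLike_of_components {K : Tensor V 4}
    (h1 : ∀ a b c d, K ![e a, e b, e c, e d] = -K ![e b, e a, e c, e d])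
    (h2 : ∀ a b c d, K ![e a, e b, e c, e d] = -K ![e a, e b, e d, e c])
    (h3 : ∀ a b c d, K ![e a, e b, e c, e d] = K ![e c, e d, e a, e b]) :
    IsRiemannLike K where
  antisymm_left u v w z := by
    have := apply_comp_perm e (Equiv.swap 0 1) (-1) (T := K) (fun I => ?_) ![v, u, w, z]
    · rw [neg_one_mul] at this
      rw [← this]
      congr 1
      ext i; fin_cases i <;> rfl
    · rw [neg_one_mul, basis_comp_vec4 e I, ← h1,
        basis_comp_vec4 e fun i => I (Equiv.swap 0 1 i)]
      rfl
  antisymm_right u v w z := by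
    have := apply_comp_perm e (Equiv.swap 2 3) (-1) (T := K) (fun I => ?_) ![u, v, z, w]
    · rw [neg_one_mul] at this
      rw [← this]
      congr 1
      ext i; fin_cases i <;> rfl
    · rw [neg_one_mul, basis_comp_vec4 e I, ← h2,
        basis_comp_vec4 e fun i => I (Equiv.swap 2 3 i)]
      rfl
  pair_symm u v w z := by
    have := apply_comp_perm e (Equiv.swap 0 2 * Equiv.swap 1 3) 1 (T := K) (fun I => ?_)
      ![w, z, u, v]
    · rw [one_mul] at this
      rw [← this]
      congr 1
      ext i; fin_cases i <;> rfl
    · rw [one_mul, basis_comp_vec4 e I, ← h3,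
        basis_comp_vec4 e fun i => I ((Equiv.swap 0 2 * Equiv.swap 1 3 : Equiv.Perm (Fin 4)) i)]
      rfl

theorem isRiemannLikeField_tensorOf [FiniteDimensional ℝ V] {Ω : Set V}
    {t : Fin n → Fin n → Fin n → Fin n → V → ℝ}
    (ht : ∀ a b c d, ContDiffOn ℝ ∞ (t a b c d) Ω)
    (h1 : ∀ x ∈ Ω, ∀ a b c d, t a b c d x = -t b a c d x)
    (h2 : ∀ x ∈ Ω, ∀ a b c d, t a b c d x = -t a b d c x)
    (h3 : ∀ x ∈ Ω, ∀ a b c d, t a b c d x = t c d a b x) :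
    IsRiemannLikeField Ω fun x => tensorOf e fun a b c d => t a b c d x where
  smooth := ContDiffOn.sum fun I _ => (ht _ _ _ _).smul contDiffOn_const
  riemannLike x hx := isRiemannLike_of_components e
    (fun a b c d => by simpa only [tensorOf_basis] using h1 x hx a b c d)
    (fun a b c d => by simpa only [tensorOf_basis] using h2 x hx a b c d)
    (fun a b c d => by simpa only [tensorOf_basis] using h3 x hx a b c d)

/-- Evaluation on fixed vectors is continuous and linear, hence commutes with the derivative. This
reduces tensor calculus to scalar components. -/
theorem nablaUp_apply (g : LinearMap.BilinForm ℝ V) (c : Fin n) {T : V → Tensor V k} {x : V}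
    (hT : DifferentiableAt ℝ T x) (v : Fin k → V) :
    nablaUp g e c T x v = dirDeriv (upVec g e c) (fun y => T y v) x := by
  have := ((ContinuousMultilinearMap.apply ℝ (fun _ : Fin k => V) ℝ v).hasFDerivAt.comp x
    hT.hasFDerivAt).fderiv
  rw [nablaUp_eq]
  exact (congrArg (fun L : V →L[ℝ] ℝ => L (upVec g e c)) this).symm

theorem doubleDiv_eq (g : LinearMap.BilinForm ℝ V) {Ω : Set V} (hΩ : IsOpen Ω)
    {K : V → Tensor V 4} (hK : ContDiffOn ℝ ∞ K Ω) {x : V} (hx : x ∈ Ω) (a b : Fin n) :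
    doubleDiv g e K x a b = ∑ c, ∑ d, dirDeriv (upVec g e c)
      (dirDeriv (upVec g e d) fun y => K y ![e a, e c, e b, e d]) x := by
  refine Finset.sum_congr rfl fun c _ => Finset.sum_congr rfl fun d _ => ?_
  have hs : ContDiffOn ℝ ∞ (nablaUp g e d K) Ω :=
    (((contDiffOn_infty_iff_fderiv_of_isOpen hΩ).1 hK).2.clm_apply
      (contDiffOn_const (c := upVec g e d))).congr fun y _ => nablaUp_eq g e d K y
  rw [nablaUp_apply e g c (differentiableAt_of_smoothOn hΩ hs hx)]
  exact dirDeriv_congr hΩ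
    (fun y hy => nablaUp_apply e g d (differentiableAt_of_smoothOn hΩ hK hy) _) _ hx

end Components

/-! ### The double divergence -/

section Divergence

variable {V : Type*} [NormedAddCommGroup V] [NormedSpace ℝ V] [FiniteDimensional ℝ V] {n : ℕ}
  {Ω : Set V}

/-- The double divergence of a Riemann-like tensor field is symmetric and divergence-free. -/
theorem isDFST_of_doubleDiv (e : Module.Basis (Fin n) ℝ V) (g : LinearMap.BilinForm ℝ V)
    (hΩ : IsOpen Ω) {K : V → Tensor V 4} {S : V → Tensor V 2} (hK : IsRiemannLikeField Ω K)
    (hS : ∀ x ∈ Ω, ∀ a b, S x ![e a, e b] = doubleDiv g e K x a b) : IsDFST g e Ω S := by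
  set k : Fin n → Fin n → Fin n → Fin n → V → ℝ := fun a b c d y => K y ![e a, e b, e c, e d]
    with hk
  set D : Fin n → (V → ℝ) → V → ℝ := fun c => dirDeriv (upVec g e c) with hD
  have hks : ∀ a b c d, ContDiffOn ℝ ∞ (k a b c d) Ω := fun a b c d =>
    contDiffOn_component hK.smooth _
  have hDs : ∀ c {f}, ContDiffOn ℝ ∞ f Ω → ContDiffOn ℝ ∞ (D c f) Ω := fun c f hf =>
    contDiffOn_dirDeriv hΩ hf _
  have hS' : ∀ x ∈ Ω, ∀ a b, S x ![e a, e b] = ∑ c, ∑ d, D c (D d (k a c b d)) x :=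
    fun x hx a b => (hS x hx a b).trans (doubleDiv_eq e g hΩ hK.smooth hx a b)
  have hsum : ∀ a b, ContDiffOn ℝ ∞ (fun x => ∑ c, ∑ d, D c (D d (k a c b d)) x) Ω :=
    fun a b => ContDiffOn.sum fun c _ => ContDiffOn.sum fun d _ => hDs c (hDs d (hks a c b d))
  have hsmooth : ContDiffOn ℝ ∞ S Ω := contDiffOn_of_components e fun I =>
    (hsum (I 0) (I 1)).congr fun x hx => by rw [basis_comp_vec2, hS' x hx]
  refine ⟨hsmooth, fun x hx u v => apply_swap_of_components e (fun a b => ?_) u v,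
    fun x hx b => ?_⟩
  · rw [hS' x hx, hS' x hx, Finset.sum_comm]
    refine Finset.sum_congr rfl fun d _ => Finset.sum_congr rfl fun c _ => ?_
    have h1 : ∀ y ∈ Ω, D d (k a c b d) y = D d (k b d a c) y := fun y hy =>
      dirDeriv_congr hΩ (fun z hz => (hK.riemannLike z hz).pair_symm _ _ _ _) _ hy
    exact (dirDeriv_congr hΩ h1 _ hx).trans (dirDeriv_comm hΩ (hks b d a c) _ _ hx)
  · set h : Fin n → Fin n → V → ℝ := fun a c y => ∑ d, D d (k a c b d) y with hh
    have hhs : ∀ a c, ContDiffOn ℝ ∞ (h a c) Ω := fun a c =>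
      ContDiffOn.sum fun d _ => hDs d (hks a c b d)
    have hanti : ∀ y ∈ Ω, ∀ a c, h a c y = -h c a y := fun y hy a c => by
      simp only [hh, ← Finset.sum_neg_distrib]
      refine Finset.sum_congr rfl fun d _ => ?_
      rw [hD, ← dirDeriv_neg]
      exact dirDeriv_congr hΩ (fun z hz => (hK.riemannLike z hz).antisymm_left _ _ _ _) _ hy
    have h1 : ∀ a, nablaUp g e a S x ![e a, e b] = ∑ c, D a (D c (h a c)) x := fun a => by
      rw [nablaUp_apply e g a (differentiableAt_of_smoothOn hΩ hsmooth hx),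
        ← dirDeriv_sum hΩ (fun c _ => hDs c (hhs a c)) _ hx]
      refine dirDeriv_congr hΩ (fun y hy => ?_) _ hx
      rw [hS' y hy]
      exact Finset.sum_congr rfl fun c _ =>
        (dirDeriv_sum hΩ (fun d _ => hDs d (hks a c b d)) _ hy).symm
    -- Exchanging $a$ and $c$ gives a sign from antisymmetry of `h` and none from commuting the
    -- derivatives, so the sum equals its own negative.
    have h2 : ∑ a, ∑ c, D a (D c (h a c)) x = -∑ a, ∑ c, D a (D c (h a c)) x := by
      conv_lhs => rw [Finset.sum_comm]
      simp only [← Finset.sum_neg_distrib]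
      refine Finset.sum_congr rfl fun a _ => Finset.sum_congr rfl fun c _ => ?_
      rw [← dirDeriv_neg]
      refine (dirDeriv_comm hΩ (hhs c a) _ _ hx).trans (dirDeriv_congr hΩ (fun y hy => ?_) _ hx)
      rw [← dirDeriv_neg]
      exact dirDeriv_congr hΩ (fun z hz => hanti z hz c a) _ hy
    rw [Finset.sum_congr rfl fun a _ => h1 a]
    linarith

/-- The covariant components of the position vector relative to `p`. -/
noncomputable def lowerCoord (g : LinearMap.BilinForm ℝ V) (e : Module.Basis (Fin n) ℝ V)
    (p : V) (a : Fin n) (x : V) : ℝ :=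
  g (x - p) (e a)

/-! ### The potential built from the position covector -/

section Potential

variable (e : Module.Basis (Fin n) ℝ V) (g : LinearMap.BilinForm ℝ V) (p : V)

theorem hasFDerivAt_lowerCoord (a : Fin n) (x : V) :
    HasFDerivAt (lowerCoord g e p a) (LinearMap.toContinuousLinearMap (g.flip (e a))) x :=
  (LinearMap.toContinuousLinearMap (g.flip (e a))).hasFDerivAt.comp x
    ((hasFDerivAt_id x).sub_const p)

theorem contDiffOn_lowerCoord (a : Fin n) : ContDiffOn ℝ ∞ (lowerCoord g e p a) Ω :=
  ((LinearMap.toContinuousLinearMap (g.flip (e a))).contDiff.comp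
    (contDiff_id.sub contDiff_const)).contDiffOn

theorem dirDeriv_lowerCoord (v : V) (a : Fin n) (x : V) :
    dirDeriv v (lowerCoord g e p a) x = g v (e a) := by
  rw [dirDeriv, (hasFDerivAt_lowerCoord e g p a x).fderiv]
  rfl

variable {e g p}

/-- Leibniz rule, with $\nabla^dX_d=n$ and $X_d\nabla^d=E$. -/
theorem sum_dirDeriv_lowerCoord_mul (hg : g.Nondegenerate) (hΩ : IsOpen Ω) {h : V → ℝ}
    (hh : ContDiffOn ℝ ∞ h Ω) {x : V} (hx : x ∈ Ω) :
    ∑ d, dirDeriv (upVec g e d) (fun y => lowerCoord g e p d y * h y) x =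
      n * h x + dirDeriv (x - p) h x := by
  have h1 : ∑ d, lowerCoord g e p d x * dirDeriv (upVec g e d) h x = dirDeriv (x - p) h x := by
    conv_rhs => rw [dirDeriv, ← sum_smul_upVec g e hg (x - p), map_sum]
    exact Finset.sum_congr rfl fun d _ => by rw [map_smul]; rfl
  rw [Finset.sum_congr rfl fun d _ =>
    dirDeriv_mul hΩ (contDiffOn_lowerCoord e g p d) hh (upVec g e d) hx, Finset.sum_add_distrib,
    h1]
  simp [dirDeriv_lowerCoord, apply_upVec_basis g e hg]

theorem sum_dirDeriv_mul_lowerCoord (hg : g.Nondegenerate) (hΩ : IsOpen Ω) (b : Fin n)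
    {h : Fin n → V → ℝ} (hh : ∀ d, ContDiffOn ℝ ∞ (h d) Ω) {x : V} (hx : x ∈ Ω) :
    ∑ d, dirDeriv (upVec g e d) (fun y => lowerCoord g e p b y * h d y) x =
      h b x + lowerCoord g e p b x * ∑ d, dirDeriv (upVec g e d) (h d) x := by
  rw [Finset.sum_congr rfl fun d _ =>
    dirDeriv_mul hΩ (contDiffOn_lowerCoord e g p b) (hh d) (upVec g e d) hx,
    Finset.sum_add_distrib, ← Finset.mul_sum]
  simp [dirDeriv_lowerCoord, apply_upVec_basis g e hg]

/-- The Kulkarni-Nomizu type product of the position covector squared with a symmetric field. -/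
noncomputable def potential (g : LinearMap.BilinForm ℝ V) (e : Module.Basis (Fin n) ℝ V) (p : V)
    (s : Fin n → Fin n → V → ℝ) (a c b d : Fin n) (x : V) : ℝ :=
  lowerCoord g e p d x * (lowerCoord g e p c x * s a b x - lowerCoord g e p a x * s c b x) -
  lowerCoord g e p b x * (lowerCoord g e p c x * s a d x - lowerCoord g e p a x * s c d x)

theorem contDiffOn_potential {s : Fin n → Fin n → V → ℝ}
    (hs : ∀ a b, ContDiffOn ℝ ∞ (s a b) Ω) (a c b d : Fin n) :
    ContDiffOn ℝ ∞ (potential g e p s a c b d) Ω := by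
  have hX := contDiffOn_lowerCoord (Ω := Ω) e g p
  exact ((hX d).mul (((hX c).mul (hs a b)).sub ((hX a).mul (hs c b)))).sub
    ((hX b).mul (((hX c).mul (hs a d)).sub ((hX a).mul (hs c d))))

/-- With $h_d=X_cs_{ad}-X_as_{cd}$ the potential is $X_dh_b-X_bh_d$. As $h$ is divergence-free, its
divergence is $(n+E)h_b-h_b$, and the last term cancels the contribution of $E$ acting on the
factors $X_c$, $X_a$. -/
theorem sum_dirDeriv_potential (hg : g.Nondegenerate) (hΩ : IsOpen Ω)
    {s : Fin n → Fin n → V → ℝ} (hs : ∀ a b, ContDiffOn ℝ ∞ (s a b) Ω)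
    (hsymm : ∀ x ∈ Ω, ∀ a b, s a b x = s b a x)
    (hdiv : ∀ x ∈ Ω, ∀ a, ∑ d, dirDeriv (upVec g e d) (s a d) x = 0)
    {x : V} (hx : x ∈ Ω) (a b c : Fin n) :
    ∑ d, dirDeriv (upVec g e d) (potential g e p s a c b d) x =
      lowerCoord g e p c x * (n * s a b x + dirDeriv (x - p) (s a b) x) -
      lowerCoord g e p a x * (n * s c b x + dirDeriv (x - p) (s c b) x) := by
  have hX := contDiffOn_lowerCoord (Ω := Ω) e g p
  have hh : ∀ d, ContDiffOn ℝ ∞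
      (fun y => lowerCoord g e p c y * s a d y - lowerCoord g e p a y * s c d y) Ω :=
    fun d => ((hX c).mul (hs a d)).sub ((hX a).mul (hs c d))
  have hEu : ∀ v : V, ∀ d, dirDeriv v
      (fun y => lowerCoord g e p c y * s a d y - lowerCoord g e p a y * s c d y) x =
      (g v (e c) * s a d x + lowerCoord g e p c x * dirDeriv v (s a d) x) -
      (g v (e a) * s c d x + lowerCoord g e p a x * dirDeriv v (s c d) x) := fun v d => by
    rw [dirDeriv_sub hΩ ((hX c).mul (hs a d)) ((hX a).mul (hs c d)) _ hx,
      dirDeriv_mul hΩ (hX c) (hs a d) _ hx, dirDeriv_mul hΩ (hX a) (hs c d) _ hx,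
      dirDeriv_lowerCoord, dirDeriv_lowerCoord]
  -- Derivatives of the $X$ factors leave $s_{ac}-s_{ca}=0$; the rest vanishes since $s$ is
  -- divergence-free.
  have h0 : ∑ d, dirDeriv (upVec g e d)
      (fun y => lowerCoord g e p c y * s a d y - lowerCoord g e p a y * s c d y) x = 0 := by
    simp only [hEu, apply_upVec_basis g e hg, Finset.sum_sub_distrib, Finset.sum_add_distrib,
      ← Finset.mul_sum, hdiv x hx]
    simp [hsymm x hx a c]
  have hsplit : ∀ d, dirDeriv (upVec g e d) (potential g e p s a c b d) x =
      dirDeriv (upVec g e d) (fun y => lowerCoord g e p d y *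
        (lowerCoord g e p c y * s a b y - lowerCoord g e p a y * s c b y)) x -
      dirDeriv (upVec g e d) (fun y => lowerCoord g e p b y *
        (lowerCoord g e p c y * s a d y - lowerCoord g e p a y * s c d y)) x := fun d =>
    dirDeriv_sub hΩ ((hX d).mul (hh b)) ((hX b).mul (hh d)) _ hx
  rw [Finset.sum_congr rfl fun d _ => hsplit d, Finset.sum_sub_distrib,
    sum_dirDeriv_lowerCoord_mul hg hΩ (hh b) hx, sum_dirDeriv_mul_lowerCoord hg hΩ b hh hx, h0,
    hEu]
  simp only [show ∀ a, g (x - p) (e a) = lowerCoord g e p a x from fun _ => rfl]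
  ring

/-- By the equation for $Es$ the first divergence is $X_cW_{ab}-X_aW_{cb}$ with $W=u+s$. As $W$ is
divergence-free, the second gives $(n+E)W_{ab}-W_{ab}$, and the two Euler equations collapse this to
$\sigma_{ab}$. -/
theorem sum_dirDeriv_sum_dirDeriv_potential (hg : g.Nondegenerate) (hΩ : IsOpen Ω)
    {s u : Fin n → Fin n → V → ℝ} {σ : Fin n → Fin n → V → ℝ}
    (hs : ∀ a b, ContDiffOn ℝ ∞ (s a b) Ω) (hu : ∀ a b, ContDiffOn ℝ ∞ (u a b) Ω)
    (hssymm : ∀ x ∈ Ω, ∀ a b, s a b x = s b a x)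
    (hsdiv : ∀ x ∈ Ω, ∀ b, ∑ a, dirDeriv (upVec g e a) (s a b) x = 0)
    (hudiv : ∀ x ∈ Ω, ∀ b, ∑ a, dirDeriv (upVec g e a) (u a b) x = 0)
    (hsE : ∀ x ∈ Ω, ∀ a b, dirDeriv (x - p) (s a b) x = u a b x - (n - 1) * s a b x)
    (huE : ∀ x ∈ Ω, ∀ a b, dirDeriv (x - p) (u a b) x = σ a b x - n * u a b x)
    {x : V} (hx : x ∈ Ω) (a b : Fin n) :
    ∑ c, ∑ d, dirDeriv (upVec g e c) (dirDeriv (upVec g e d) (potential g e p s a c b d)) x =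
      σ a b x := by
  have hX := contDiffOn_lowerCoord (Ω := Ω) e g p
  have hW : ∀ a b, ContDiffOn ℝ ∞ (fun y => u a b y + s a b y) Ω := fun a b =>
    (hu a b).add (hs a b)
  have hsdiv' : ∀ x ∈ Ω, ∀ a, ∑ d, dirDeriv (upVec g e d) (s a d) x = 0 := fun x hx a => by
    rw [← hsdiv x hx a]
    exact Finset.sum_congr rfl fun d _ => dirDeriv_congr hΩ (fun y hy => hssymm y hy a d) _ hx
  have hinner : ∀ c, ∑ d, dirDeriv (upVec g e c)
      (dirDeriv (upVec g e d) (potential g e p s a c b d)) x =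
      dirDeriv (upVec g e c) (fun y => lowerCoord g e p c y * (u a b y + s a b y)) x -
      dirDeriv (upVec g e c) (fun y => lowerCoord g e p a y * (u c b y + s c b y)) x := by
    intro c
    rw [← dirDeriv_sum hΩ (fun d _ => contDiffOn_dirDeriv hΩ (contDiffOn_potential hs a c b d) _)
      _ hx, ← dirDeriv_sub hΩ ((hX c).mul (hW a b)) ((hX a).mul (hW c b)) _ hx]
    refine dirDeriv_congr hΩ (fun y hy => ?_) _ hx
    rw [sum_dirDeriv_potential hg hΩ hs hssymm hsdiv' hy, hsE y hy, hsE y hy]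
    ring
  rw [Finset.sum_congr rfl fun c _ => hinner c, Finset.sum_sub_distrib,
    sum_dirDeriv_lowerCoord_mul hg hΩ (hW a b) hx,
    sum_dirDeriv_mul_lowerCoord hg hΩ a (fun c => hW c b) hx,
    dirDeriv_add hΩ (hu a b) (hs a b) _ hx, hsE x hx, huE x hx,
    Finset.sum_congr rfl fun c _ => dirDeriv_add hΩ (hu c b) (hs c b) (upVec g e c) hx,
    Finset.sum_add_distrib, hsdiv x hx, hudiv x hx]
  ring

end Potential

end Divergence

/-! ### Divergences and Euler equations of ray averages -/

section RayAverageAlgebra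

variable {V : Type*} [NormedAddCommGroup V] [NormedSpace ℝ V] {p : V} {Ω : Set V}

theorem intervalIntegrable_ray {w : ℝ → ℝ} {f : V → ℝ} (hs : StarConvex ℝ p Ω)
    (hw : Continuous w) (hf : ContinuousOn f Ω) {x : V} (hx : x ∈ Ω) :
    IntervalIntegrable (fun t : ℝ => w t * f (p + t • (x - p))) MeasureTheory.volume 0 1 :=
  (hw.continuousOn.mul (continuousOn_comp_ray hs hf hx)).intervalIntegrable

theorem rayAverage_congr (hs : StarConvex ℝ p Ω) (w : ℝ → ℝ) {f h : V → ℝ}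
    (hfh : ∀ x ∈ Ω, f x = h x) {x : V} (hx : x ∈ Ω) :
    rayAverage p w f x = rayAverage p w h x := by
  refine intervalIntegral.integral_congr fun t ht => ?_
  rw [Set.uIcc_of_le zero_le_one] at ht
  simp only [hfh _ (hs.add_smul_sub_mem hx ht.1 ht.2)]

theorem rayAverage_sum (hs : StarConvex ℝ p Ω) {w : ℝ → ℝ} (hw : Continuous w) {ι : Type*}
    {s : Finset ι} {f : ι → V → ℝ} (hf : ∀ i ∈ s, ContinuousOn (f i) Ω) {x : V} (hx : x ∈ Ω) :
    ∑ i ∈ s, rayAverage p w (f i) x = rayAverage p w (fun y => ∑ i ∈ s, f i y) x := by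
  simp only [rayAverage, Finset.mul_sum]
  exact (intervalIntegral.integral_finsetSum fun i hi =>
    intervalIntegrable_ray hs hw (hf i hi) hx).symm

/-- Averaging along rays preserves vanishing of divergences. -/
theorem sum_dirDeriv_rayAverage [FiniteDimensional ℝ V] (hs : StarConvex ℝ p Ω) (hΩ : IsOpen Ω)
    {w : ℝ → ℝ} (hw : Continuous w) {ι : Type*} [Fintype ι] {E : ι → V} {f : ι → V → ℝ}
    (hf : ∀ i, ContDiffOn ℝ ∞ (f i) Ω) (hdiv : ∀ x ∈ Ω, ∑ i, dirDeriv (E i) (f i) x = 0)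
    {x : V} (hx : x ∈ Ω) : ∑ i, dirDeriv (E i) (rayAverage p w (f i)) x = 0 := by
  have h1 : ∀ i, dirDeriv (E i) (rayAverage p w (f i)) x =
      rayAverage p (fun t => w t * t) (dirDeriv (E i) (f i)) x := fun i =>
    fderiv_rayAverage hs hΩ hw ((hf i).of_le (by exact_mod_cast le_top)) hx (E i)
  rw [Finset.sum_congr rfl fun i _ => h1 i, rayAverage_sum hs (by fun_prop)
    (fun i _ => (contDiffOn_dirDeriv hΩ (hf i) (E i)).continuousOn) hx,
    rayAverage_congr hs _ hdiv hx]
  simp [rayAverage]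

/-- For $w=t^{k+1}$ one has $w(1)=1$ and $(wt)'=(k+2)w$. With $k=n-2$ this is $(E+n)u=S$. -/
theorem dirDeriv_rayAverage_pow [FiniteDimensional ℝ V] (hs : StarConvex ℝ p Ω) (hΩ : IsOpen Ω)
    (k : ℕ) {f : V → ℝ} (hf : ContDiffOn ℝ ∞ f Ω) {x : V} (hx : x ∈ Ω) :
    dirDeriv (x - p) (rayAverage p (fun t => t ^ (k + 1)) f) x =
      f x - (k + 2 : ℝ) * rayAverage p (fun t => t ^ (k + 1)) f x := by
  have h := fderiv_rayAverage_sub hs hΩ (w := fun t : ℝ => t ^ (k + 1)) (by fun_prop)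
    (w' := fun t => (k + 2 : ℝ) * t ^ (k + 1)) (by fun_prop) (fun t => ?_)
    (hf.of_le (by exact_mod_cast le_top)) hx
  · rw [dirDeriv, h]
    simp [rayAverage, mul_assoc]
  · exact (hasDerivAt_pow (k + 2) t).congr_deriv (by push_cast; rfl)

/-- The factor $1-t$ kills the boundary term at $t=1$, and
$(t^{k+1}-t^{k+2})'=(k+1)t^k(1-t)-t^{k+1}$. With $k=n-2$ this is $(E+n-1)s=u$. -/
theorem dirDeriv_rayAverage_pow_mul_one_sub [FiniteDimensional ℝ V] (hs : StarConvex ℝ p Ω)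
    (hΩ : IsOpen Ω) (k : ℕ) {f : V → ℝ} (hf : ContDiffOn ℝ ∞ f Ω) {x : V} (hx : x ∈ Ω) :
    dirDeriv (x - p) (rayAverage p (fun t => t ^ k * (1 - t)) f) x =
      rayAverage p (fun t => t ^ (k + 1)) f x -
        (k + 1 : ℝ) * rayAverage p (fun t => t ^ k * (1 - t)) f x := by
  have h := fderiv_rayAverage_sub hs hΩ (w := fun t : ℝ => t ^ k * (1 - t)) (by fun_prop)
    (w' := fun t => (k + 1 : ℝ) * (t ^ k * (1 - t)) - t ^ (k + 1)) (by fun_prop) (fun t => ?_)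
    (hf.of_le (by exact_mod_cast le_top)) hx
  · rw [dirDeriv, h]
    simp only [rayAverage, sub_mul, mul_assoc]
    rw [intervalIntegral.integral_sub, intervalIntegral.integral_const_mul]
    · simp
    · have := intervalIntegrable_ray hs (w := fun t : ℝ => (k + 1 : ℝ) * (t ^ k * (1 - t)))
        (by fun_prop) hf.continuousOn hx
      simpa only [mul_assoc, sub_mul] using this
    · exact intervalIntegrable_ray hs (by fun_prop) hf.continuousOn hx
  · have h1 : (fun t : ℝ => t ^ k * (1 - t) * t) = fun t => t ^ (k + 1) - t ^ (k + 2) := by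
      ext t; ring
    rw [h1]
    refine ((hasDerivAt_pow (k + 1) t).fun_sub (hasDerivAt_pow (k + 2) t)).congr_deriv ?_
    simp only [Nat.add_sub_cancel, show k + 2 - 1 = k + 1 from rfl]
    push_cast
    ring

end RayAverageAlgebra

/-! ### Existence of a Riemann-like potential -/

section Existence

variable {V : Type*} [NormedAddCommGroup V] [NormedSpace ℝ V] [FiniteDimensional ℝ V] {n : ℕ}
  {Ω : Set V}

/-- On a star-shaped open set in dimension different from one, every smooth symmetric
divergence-free field is the double divergence of a Riemann-like field. -/
theorem exists_isRiemannLikeField (e : Module.Basis (Fin n) ℝ V) {g : LinearMap.BilinForm ℝ V}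
    (hg : g.Nondegenerate) (hΩ : IsOpen Ω) (hn : n ≠ 1) {p : V} (hp : StarConvex ℝ p Ω)
    {S : V → Tensor V 2} (hS : IsDFST g e Ω S) :
    ∃ K : V → Tensor V 4, IsRiemannLikeField Ω K ∧
      ∀ x ∈ Ω, ∀ a b, S x ![e a, e b] = doubleDiv g e K x a b := by
  -- The weight $t^{n-2}$ needs $n\ge2$; for $n=0$ there are no components to match.
  obtain rfl | ⟨k, rfl⟩ : n = 0 ∨ ∃ k, n = k + 2 := by
    rcases n with _ | _ | k
    · exact .inl rfl
    · exact absurd rfl hn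
    · exact .inr ⟨k, rfl⟩
  · exact ⟨0, ⟨contDiffOn_const, fun x _ => ⟨by simp, by simp, by simp⟩⟩, fun _ _ a => a.elim0⟩
  set σ : Fin (k + 2) → Fin (k + 2) → V → ℝ := fun a b x => S x ![e a, e b] with hσ
  have hσs : ∀ a b, ContDiffOn ℝ ∞ (σ a b) Ω := fun a b => contDiffOn_component hS.smooth _
  have hσsymm : ∀ a b, ∀ x ∈ Ω, σ a b x = σ b a x := fun a b x hx => hS.symm x hx _ _
  have hσdiv : ∀ b, ∀ x ∈ Ω, ∑ a, dirDeriv (upVec g e a) (σ a b) x = 0 := fun b x hx => by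
    rw [← hS.div_eq_zero x hx b]
    exact Finset.sum_congr rfl fun a _ =>
      (nablaUp_apply e g a (differentiableAt_of_smoothOn hΩ hS.smooth hx) _).symm
  set s : Fin (k + 2) → Fin (k + 2) → V → ℝ := fun a b =>
    rayAverage p (fun t => t ^ k * (1 - t)) (σ a b) with hs_def
  set u : Fin (k + 2) → Fin (k + 2) → V → ℝ := fun a b =>
    rayAverage p (fun t => t ^ (k + 1)) (σ a b) with hu_def
  have hs : ∀ a b, ContDiffOn ℝ ∞ (s a b) Ω := fun a b =>
    contDiffOn_rayAverage hp hΩ (by fun_prop) (hσs a b)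
  have hu : ∀ a b, ContDiffOn ℝ ∞ (u a b) Ω := fun a b =>
    contDiffOn_rayAverage hp hΩ (by fun_prop) (hσs a b)
  have hssymm : ∀ x ∈ Ω, ∀ a b, s a b x = s b a x := fun x hx a b =>
    rayAverage_congr hp _ (hσsymm a b) hx
  have hRL : IsRiemannLikeField Ω
      fun x => tensorOf e fun a c b d => potential g e p s a c b d x := by
    refine isRiemannLikeField_tensorOf e (contDiffOn_potential hs) ?_ ?_ ?_
    · intro x _ a c b d
      simp only [potential]
      ring
    · intro x _ a c b d
      simp only [potential]
      ring
    · intro x hx a c b d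
      simp only [potential, hssymm x hx b a, hssymm x hx b c, hssymm x hx d a, hssymm x hx d c]
      ring
  refine ⟨_, hRL, fun x hx a b => ?_⟩
  rw [doubleDiv_eq e g hΩ hRL.smooth hx]
  simp only [tensorOf_basis]
  refine (sum_dirDeriv_sum_dirDeriv_potential (p := p) (σ := σ) hg hΩ hs hu hssymm
    (fun x hx b => sum_dirDeriv_rayAverage hp hΩ (by fun_prop) (fun a => hσs a b) (hσdiv b) hx)
    (fun x hx b => sum_dirDeriv_rayAverage hp hΩ (by fun_prop) (fun a => hσs a b) (hσdiv b) hx)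
    (fun x hx a b => ?_) (fun x hx a b => ?_) hx a b).symm
  · rw [hs_def, dirDeriv_rayAverage_pow_mul_one_sub hp hΩ k (hσs a b) hx]
    push_cast
    ring
  · rw [hu_def, dirDeriv_rayAverage_pow hp hΩ k (hσs a b) hx]
    push_cast
    ring

end Existence

/-! ### Alternating forms and symmetric products of them -/

section Bivectors

variable {V : Type*} [NormedAddCommGroup V] [NormedSpace ℝ V] {n m : ℕ}
  (e : Module.Basis (Fin n) ℝ V)

/-- The exterior product of two coordinate functionals. -/
noncomputable def coordWedge (a b : Fin n) : V [⋀^Fin 2]→ₗ[ℝ] ℝ :=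
  (Matrix.detRowAlternating (n := Fin 2) (R := ℝ)).compLinearMap
    (LinearMap.pi ![e.coord a, e.coord b])

theorem coordWedge_basis (a b c d : Fin n) :
    coordWedge e c d ![e a, e b] =
      (if a = c then 1 else 0) * (if b = d then 1 else 0) -
      (if a = d then 1 else 0) * (if b = c then 1 else 0) := by
  have : coordWedge e c d ![e a, e b] =
      Matrix.det (Matrix.of fun i j : Fin 2 =>
      (![e.coord c, e.coord d] j) (![e a, e b] i)) := rfl
  rw [this, Matrix.det_fin_two]
  simp [Finsupp.single_apply]

theorem alternating_swap (α : V [⋀^Fin 2]→ₗ[ℝ] ℝ) (u v : V) : α ![u, v] = -α ![v, u] := by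
  rw [← α.map_swap ![v, u] (i := 0) (j := 1) (by simp)]
  congr 1
  ext i; fin_cases i <;> rfl

/-- The coefficients of an alternating form in a basis of `Λ²V*` are linear in its components. -/
theorem exists_dual_coefficients (η : Module.Basis (Fin m) ℝ (V [⋀^Fin 2]→ₗ[ℝ] ℝ)) :
    ∃ q : Fin m → Fin n → Fin n → ℝ, ∀ A : Fin n → Fin n → ℝ, (∀ a b, A a b = -A b a) →
      ∀ a b, ∑ j, (∑ c, ∑ d, q j c d * A c d) * η j ![e a, e b] = A a b := by
  -- The division by 2 reflects $A=\frac12\sum_{c,d}A_{cd}\,e^c\wedge e^d$, the sum over all ordered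
  -- pairs counting each wedge twice.
  refine ⟨fun j c d => η.repr (coordWedge e c d) j / 2, fun A hA a b => ?_⟩
  have h1 : ∀ c d, ∑ j, η.repr (coordWedge e c d) j * η j ![e a, e b] =
      coordWedge e c d ![e a, e b] := fun c d => by
    let L : (V [⋀^Fin 2]→ₗ[ℝ] ℝ) →ₗ[ℝ] ℝ :=
      { toFun := fun α => α ![e a, e b], map_add' := fun _ _ => rfl, map_smul' := fun _ _ => rfl }
    have h := congrArg L (η.sum_repr (coordWedge e c d))
    simp only [map_sum, map_smul, smul_eq_mul] at h
    exact h
  have h2 : ∑ j, (∑ c, ∑ d, η.repr (coordWedge e c d) j / 2 * A c d) * η j ![e a, e b] =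
      ∑ c, ∑ d, coordWedge e c d ![e a, e b] * (A c d / 2) := by
    simp only [← h1, Finset.sum_mul]
    rw [Finset.sum_comm]
    refine Finset.sum_congr rfl fun c _ => ?_
    rw [Finset.sum_comm]
    exact Finset.sum_congr rfl fun d _ => Finset.sum_congr rfl fun j _ => by ring
  rw [h2]
  simp only [coordWedge_basis, sub_mul, Finset.sum_sub_distrib, ite_mul, one_mul, zero_mul,
    Finset.sum_ite_eq, Finset.mem_univ, if_true]
  simp
  linarith [hA a b]

end Bivectors

/-- The factor $\frac12$ compensates for $M_{ii}$ being doubled. The upper triangular array `N` and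
`M` have equal symmetrizations, hence equal total sums. -/
theorem sum_Ici_symmetrize {m : ℕ} (M : Fin m → Fin m → ℝ) :
    ∑ i, ∑ j ∈ Finset.Ici i, (M i j + M j i) * (if i = j then 1 / 2 else 1) =
      ∑ i, ∑ j, M i j := by
  set N : Fin m → Fin m → ℝ := fun i j =>
    if i ≤ j then (M i j + M j i) * (if i = j then 1 / 2 else 1) else 0 with hN
  have h1 : ∑ i, ∑ j ∈ Finset.Ici i, (M i j + M j i) * (if i = j then 1 / 2 else 1) =
      ∑ i, ∑ j, N i j := by
    refine Finset.sum_congr rfl fun i _ => ?_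
    rw [← Finset.sum_filter]
    congr 1
    ext j; simp
  have h2 : ∀ i j, N i j + N j i = M i j + M j i := fun i j => by
    simp only [hN]
    rcases lt_trichotomy i j with h | h | h
    · simp [h.le, h.ne, h.not_ge]
    · subst h; simp; ring
    · simp [h.le, h.ne, h.not_ge, add_comm]
  have h3 : ∑ i, ∑ j, N i j + ∑ i, ∑ j, N j i = ∑ i, ∑ j, M i j + ∑ i, ∑ j, M j i := by
    simp only [← Finset.sum_add_distrib, h2]
  rw [Finset.sum_comm (f := fun i j => N j i), Finset.sum_comm (f := fun i j => M j i)] at h3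
  linarith

/-! ### Scalar potentials -/

section Scalars

variable {V : Type*} [NormedAddCommGroup V] [NormedSpace ℝ V] {n m : ℕ} {Ω : Set V}

theorem dirDeriv_dirDeriv_sum_const_mul (hΩ : IsOpen Ω) {ι : Type*} (s : Finset ι) (r : ι → ℝ)
    {f : ι → V → ℝ} (hf : ∀ i, ContDiffOn ℝ ∞ (f i) Ω) (u v : V) {x : V} (hx : x ∈ Ω) :
    dirDeriv u (dirDeriv v fun y => ∑ i ∈ s, r i * f i y) x =
      ∑ i ∈ s, r i * dirDeriv u (dirDeriv v (f i)) x := by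
  have hrf : ∀ i, ContDiffOn ℝ ∞ (fun y => r i * f i y) Ω := fun i => contDiffOn_const.mul (hf i)
  have h1 : ∀ y ∈ Ω, dirDeriv v (fun y => ∑ i ∈ s, r i * f i y) y =
      ∑ i ∈ s, r i * dirDeriv v (f i) y := fun y hy => by
    rw [dirDeriv_sum hΩ (fun i _ => hrf i) v hy]
    exact Finset.sum_congr rfl fun i _ => dirDeriv_const_mul hΩ (hf i) _ v hy
  rw [dirDeriv_congr hΩ h1 u hx, dirDeriv_sum hΩ
    (fun i _ => contDiffOn_const.mul (contDiffOn_dirDeriv hΩ (hf i) v)) u hx]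
  exact Finset.sum_congr rfl fun i _ =>
    dirDeriv_const_mul hΩ (contDiffOn_dirDeriv hΩ (hf i) v) _ u hx

/-- The tensors $T^{(i,j)}$ have constant components, so they pass through both derivatives. -/
theorem potentialSum_eq (g : LinearMap.BilinForm ℝ V) (e : Module.Basis (Fin n) ℝ V)
    (η : Module.Basis (Fin m) ℝ (V [⋀^Fin 2]→ₗ[ℝ] ℝ)) (hΩ : IsOpen Ω) {f : Fin m → Fin m → V → ℝ}
    (hf : ∀ i j, ContDiffOn ℝ ∞ (f i j) Ω) {x : V} (hx : x ∈ Ω) (a b : Fin n) :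
    potentialSum g e η f x a b = ∑ c, ∑ d, dirDeriv (upVec g e c) (dirDeriv (upVec g e d)
      fun y => ∑ i, ∑ j ∈ Finset.Ici i, basisTensor e η i j a c b d * f i j y) x := by
  have h : ∀ c d, dirDeriv (upVec g e c) (dirDeriv (upVec g e d)
      fun y => ∑ i, ∑ j ∈ Finset.Ici i, basisTensor e η i j a c b d * f i j y) x =
      ∑ q ∈ Finset.univ.sigma fun i : Fin m => Finset.Ici i, basisTensor e η q.1 q.2 a c b d *
        dirDeriv (upVec g e c) (dirDeriv (upVec g e d) (f q.1 q.2)) x := fun c d => by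
    rw [← dirDeriv_dirDeriv_sum_const_mul hΩ _ _ (fun q : (_ : Fin m) × Fin m => hf q.1 q.2)
      _ _ hx]
    simp only [Finset.sum_sigma]
  simp only [potentialSum, nablaUp_eq_dirDeriv, h]
  rw [Finset.sum_sigma', Finset.sum_comm]
  exact Finset.sum_congr rfl fun c _ => Finset.sum_comm

/-- A Riemann-like field is a combination of the tensors `T^{(i,j)}` with smooth coefficients. -/
theorem exists_coefficients (e : Module.Basis (Fin n) ℝ V)
    (η : Module.Basis (Fin m) ℝ (V [⋀^Fin 2]→ₗ[ℝ] ℝ)) {K : V → Tensor V 4}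
    (hK : IsRiemannLikeField Ω K) :
    ∃ f : Fin m → Fin m → V → ℝ, (∀ i j, ContDiffOn ℝ ∞ (f i j) Ω) ∧
      ∀ x ∈ Ω, ∀ a b c d, K x ![e a, e b, e c, e d] =
        ∑ i, ∑ j ∈ Finset.Ici i, basisTensor e η i j a b c d * f i j x := by
  obtain ⟨q, hq⟩ := exists_dual_coefficients e η
  -- The dual coefficients are applied to each antisymmetric index pair; as constant linear
  -- combinations of components, the `κ i j` are smooth.
  set κ : Fin m → Fin m → V → ℝ := fun i j x =>
    ∑ a, ∑ b, q i a b * ∑ c, ∑ d, q j c d * K x ![e a, e b, e c, e d] with hκ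
  have hκs : ∀ i j, ContDiffOn ℝ ∞ (κ i j) Ω := fun i j =>
    ContDiffOn.sum fun a _ => ContDiffOn.sum fun b _ => contDiffOn_const.mul <|
      ContDiffOn.sum fun c _ => ContDiffOn.sum fun d _ => contDiffOn_const.mul <|
        contDiffOn_component hK.smooth _
  have hκsymm : ∀ x ∈ Ω, ∀ i j, κ i j x = κ j i x := fun x hx i j => by
    have h : ∀ i j, κ i j x = ∑ r : Fin n × Fin n, ∑ s : Fin n × Fin n,
        q i r.1 r.2 * (q j s.1 s.2 * K x ![e r.1, e r.2, e s.1, e s.2]) := fun i j => by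
      simp only [hκ, Fintype.sum_prod_type, Finset.mul_sum]
    rw [h, h, Finset.sum_comm]
    refine Finset.sum_congr rfl fun r _ => Finset.sum_congr rfl fun s _ => ?_
    rw [(hK.riemannLike x hx).pair_symm (e r.1)]
    ring
  have hexp : ∀ x ∈ Ω, ∀ a b c d, K x ![e a, e b, e c, e d] =
      ∑ i, ∑ j, κ i j x * (η i ![e a, e b] * η j ![e c, e d]) := fun x hx a b c d => by
    have hR := hK.riemannLike x hx
    rw [Finset.sum_comm]
    have h1 : ∀ a b, ∑ j, (∑ c, ∑ d, q j c d * K x ![e a, e b, e c, e d]) * η j ![e c, e d] =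
        K x ![e a, e b, e c, e d] := fun a b =>
      hq (fun c d => K x ![e a, e b, e c, e d]) (fun c d => hR.antisymm_right _ _ _ _) c d
    have h2 : ∀ j, ∑ i, κ i j x * η i ![e a, e b] =
        ∑ c, ∑ d, q j c d * K x ![e a, e b, e c, e d] := fun j =>
      hq (fun a b => ∑ c, ∑ d, q j c d * K x ![e a, e b, e c, e d]) (fun a b => by
        simp only [← Finset.sum_neg_distrib, ← mul_neg]
        exact Finset.sum_congr rfl fun c _ => Finset.sum_congr rfl fun d _ => by
          rw [hR.antisymm_left]) a b
    rw [← h1]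
    refine Finset.sum_congr rfl fun j _ => ?_
    rw [← h2, Finset.sum_mul]
    exact Finset.sum_congr rfl fun i _ => by ring
  -- $T^{(i,i)}=2\,\omega_i\otimes\omega_i$, hence the half on the diagonal.
  refine ⟨fun i j x => κ i j x * (if i = j then 1 / 2 else 1), fun i j =>
    (hκs i j).mul contDiffOn_const, fun x hx a b c d => ?_⟩
  rw [hexp x hx, ← sum_Ici_symmetrize]
  refine Finset.sum_congr rfl fun i _ => Finset.sum_congr rfl fun j _ => ?_
  rw [hκsymm x hx j i, basisTensor]
  ring

/-- This turns arbitrary scalar potentials back into a Riemann-like field, so that the converse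
follows from the double divergence case. -/
theorem isRiemannLikeField_sum_basisTensor [FiniteDimensional ℝ V] (e : Module.Basis (Fin n) ℝ V)
    (η : Module.Basis (Fin m) ℝ (V [⋀^Fin 2]→ₗ[ℝ] ℝ)) {f : Fin m → Fin m → V → ℝ}
    (hf : ∀ i j, ContDiffOn ℝ ∞ (f i j) Ω) :
    IsRiemannLikeField Ω fun x => tensorOf e fun a b c d =>
      ∑ i, ∑ j ∈ Finset.Ici i, basisTensor e η i j a b c d * f i j x := by
  refine isRiemannLikeField_tensorOf e (t := fun a b c d x =>
    ∑ i, ∑ j ∈ Finset.Ici i, basisTensor e η i j a b c d * f i j x)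
    (fun a b c d => ContDiffOn.sum fun i _ => ContDiffOn.sum fun j _ =>
      contDiffOn_const.mul (hf i j)) ?_ ?_ ?_
  · intro x _ a b c d
    simp only [← Finset.sum_neg_distrib]
    refine Finset.sum_congr rfl fun i _ => Finset.sum_congr rfl fun j _ => ?_
    rw [basisTensor, basisTensor, alternating_swap (η i) (e a), alternating_swap (η j) (e a)]
    ring
  · intro x _ a b c d
    simp only [← Finset.sum_neg_distrib]
    refine Finset.sum_congr rfl fun i _ => Finset.sum_congr rfl fun j _ => ?_
    rw [basisTensor, basisTensor, alternating_swap (η i) (e c), alternating_swap (η j) (e c)]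
    ring
  · intro x _ a b c d
    refine Finset.sum_congr rfl fun i _ => Finset.sum_congr rfl fun j _ => ?_
    rw [basisTensor, basisTensor]
    ring

end Scalars

end FlatTensor

theorem theorem1 {V : Type*} [NormedAddCommGroup V] [NormedSpace ℝ V] {n m : ℕ}
    (e : Module.Basis (Fin n) ℝ V)
    (g : LinearMap.BilinForm ℝ V) (hg_symm : g.IsSymm) (hg : g.Nondegenerate)
    (η : Module.Basis (Fin m) ℝ (V [⋀^Fin 2]→ₗ[ℝ] ℝ))
    (Ω : Set V) (hΩ : IsOpen Ω) :
    -- on every open set, `∇^c ∇^d K_{acbd}` is symmetric and divergence-free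
    (∀ (K : V → FlatTensor.Tensor V 4) (S : V → FlatTensor.Tensor V 2),
      FlatTensor.IsRiemannLikeField Ω K →
      (∀ x ∈ Ω, ∀ a b, S x ![e a, e b] = FlatTensor.doubleDiv g e K x a b) →
      FlatTensor.IsDFST g e Ω S) ∧
    -- on star-shaped open sets, in particular on `V`, these are all such tensor fields
    (n ≠ 1 → ∀ p : V, StarConvex ℝ p Ω → ∀ S : V → FlatTensor.Tensor V 2,
      (FlatTensor.IsDFST g e Ω S ↔
        ∃ K : V → FlatTensor.Tensor V 4, FlatTensor.IsRiemannLikeField Ω K ∧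
          ∀ x ∈ Ω, ∀ a b, S x ![e a, e b] = FlatTensor.doubleDiv g e K x a b) ∧
      (FlatTensor.IsDFST g e Ω S ↔
        ∃ f : Fin m → Fin m → V → ℝ, (∀ i j, ContDiffOn ℝ ∞ (f i j) Ω) ∧
          ∀ x ∈ Ω, ∀ a b, S x ![e a, e b] = FlatTensor.potentialSum g e η f x a b)) := by
  have : FiniteDimensional ℝ V := e.finiteDimensional_of_finite
  refine ⟨fun K S hK hS => FlatTensor.isDFST_of_doubleDiv e g hΩ hK hS, fun hn p hp S => ⟨⟨fun hS =>
    FlatTensor.exists_isRiemannLikeField e hg hΩ hn hp hS, fun ⟨K, hK, hS⟩ =>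
    FlatTensor.isDFST_of_doubleDiv e g hΩ hK hS⟩, fun hS => ?_, fun ⟨f, hf, hS⟩ => ?_⟩⟩
  · obtain ⟨K, hK, hSK⟩ := FlatTensor.exists_isRiemannLikeField e hg hΩ hn hp hS
    obtain ⟨f, hf, hKf⟩ := FlatTensor.exists_coefficients e η hK
    refine ⟨f, hf, fun x hx a b => ?_⟩
    rw [hSK x hx, FlatTensor.doubleDiv_eq e g hΩ hK.smooth hx, FlatTensor.potentialSum_eq g e η hΩ hf hx]
    exact Finset.sum_congr rfl fun c _ => Finset.sum_congr rfl fun d _ =>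
      FlatTensor.dirDeriv_congr hΩ (fun y hy => FlatTensor.dirDeriv_congr hΩ (fun z hz => hKf z hz _ _ _ _) _ hy) _ hx
  · have hK := FlatTensor.isRiemannLikeField_sum_basisTensor e η hf
    refine FlatTensor.isDFST_of_doubleDiv e g hΩ hK fun x hx a b => ?_
    rw [hS x hx, FlatTensor.doubleDiv_eq e g hΩ hK.smooth hx, FlatTensor.potentialSum_eq g e η hΩ hf hx]
    simp only [FlatTensor.tensorOf_basis]
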